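/- **Theorem 1.** Let $\xi(s)=(s-1)\pi^{-s/2}\Gamma(1+s/2)\zeta(s)$ be Riemann's $\xi$-function. Let $1<c<2$ and let $s$ be a complex number in the critical strip $0<\operatorname{Re}s<1$. Then $$\xi(s)=1-\frac{\pi^{1/4}}{2\,\Gamma(3/4)}-\frac{1}{2\pi i}\int_{c-i\infty}^{c+i\infty}\frac{\xi(t)}{t}\left[\frac{2s(1-s)-t}{s(1-s)-t(1-t)}\right]dt$$ and $$\xi(s)=\frac12+\frac{1}{2\pi i}\int_{c-i\infty}^{c+i\infty}\frac{\xi(t)}{t}\left[\frac{1}{1-t}-\frac{2s(1-s)-t}{s(1-s)-t(1-t)}\right]dt,$$ where both integrals are taken upwards along the line $\operatorname{Re}t=c$ and converge absolutely. -/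

import Mathlib

noncomputable section

/-- Riemann's function `ξ(s) = (s - 1) π^(-s/2) Γ(1 + s/2) ζ(s)`.  The formula is the literal value
wherever its factors are finite, i.e. away from `s = 1` and `s = -2, -4, …`; those removable
singularities lie outside both the open critical strip and the lines `Re t = c > 1`. -/
def xi (s : ℂ) : ℂ :=
  (s - 1) * (Real.pi : ℂ) ^ (-s / 2) * Complex.Gamma (1 + s / 2) * riemannZeta s

/-- The integral `∫_{c-i∞}^{c+i∞} f(t) dt` along the upward line `t = c + i y`, `dt = i dy`. -/
def verticalLineIntegral (c : ℝ) (f : ℂ → ℂ) : ℂ :=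
  ∫ y : ℝ, f ((c : ℂ) + (y : ℂ) * Complex.I) * Complex.I

end

/-!
Write `A = s(1 - s)`. The first kernel splits as
`(2A - t) / (t (A - t(1 - t))) = 2/t - 1/(t - s) - 1/(t - (1 - s))`,
and the second is `1/(t(1 - t)) = 1/t - 1/(t - 1)` minus the first, so everything reduces to the
integrals `I(p)` of `ξ(t) / (t - p)` along `Re t = c`, for `p = s, 1 - s, 0, 1`.

* `integral_symmetric_kernel`: moving the line from `Re t = c` to `Re t = 1 - c` past the pole at
  `s` and folding it back by `ξ(1 - t) = ξ(t)` gives `I(s) + I(1 - s) = 2πi ξ(s)`. Horizontal sides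
  of the contour are controlled by a Gaussian damping factor that respects the symmetry, so only a
  polynomial bound on `ξ` in the strip is needed. The case `s = 0` is `I(0) + I(1) = πi`. This
  already proves the second formula.
* `integral_completedRiemannZeta_vertical`: since `ξ(t)/(t - 1) - ξ(t)/t = Λ(t)/2` and `Λ(2t)` is the
  Mellin transform of `(θ₃ - 1)/2`, where `θ₃(x) = ∑ e^{-πn²x}`, Mellin inversion at `x = 1` gives
  `I(1) - I(0) = πi (θ₃(1) - 1)`. Hence `2 I(0) = 2πi (1 - θ₃(1)/2)`.
* `thetaThree_one`: `θ₃(1) = π^{1/4} / Γ(3/4)`. Under `x ↦ 2x` the pair `(θ₃², θ₄²)` undergoes an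
  arithmetic-geometric mean step and tends to `(1, 1)`; Gauss's elliptic integral is invariant under
  such steps (`agmIntegral_step`), so it takes the value `π` at `(θ₃(1)², θ₄(1)²)`. The functional
  equation of `θ₃` forces `θ₃(1)⁴ = 2 θ₄(1)⁴`, which makes this integral lemniscatic, and the
  lemniscatic integral is `Γ(1/4)² / (4√π)`.
-/

/-! ### Theta constants and the arithmetic-geometric mean -/

/-- The theta constant `θ₃(e^{-πx}) = ∑ e^{-πn²x}`, as a function of the real variable `x`.
The sum diverges for `x ≤ 0`, where the value is junk. -/
noncomputable def thetaThree (x : ℝ) : ℝ := ∑' n : ℤ, Real.exp (-Real.pi * (n : ℝ) ^ 2 * x)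

/-- The theta constant `θ₄(e^{-πx}) = ∑ (-1)^n e^{-πn²x}`, as a function of the real variable
`x`; junk for `x ≤ 0`, where the sum diverges. -/
noncomputable def thetaFour (x : ℝ) : ℝ :=
  ∑' n : ℤ, (-1 : ℝ) ^ n * Real.exp (-Real.pi * (n : ℝ) ^ 2 * x)

theorem hasSum_thetaThree {x : ℝ} (hx : 0 < x) :
    HasSum (fun n : ℤ => Real.exp (-Real.pi * (n : ℝ) ^ 2 * x)) (HurwitzZeta.evenKernel 0 x) := by
  simpa using HurwitzZeta.hasSum_int_evenKernel 0 hx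

theorem thetaThree_eq_evenKernel {x : ℝ} (hx : 0 < x) :
    thetaThree x = HurwitzZeta.evenKernel 0 x := (hasSum_thetaThree hx).tsum_eq

theorem summable_thetaThree {x : ℝ} (hx : 0 < x) :
    Summable (fun n : ℤ => Real.exp (-Real.pi * (n : ℝ) ^ 2 * x)) := (hasSum_thetaThree hx).summable

theorem summable_norm_thetaFour {x : ℝ} (hx : 0 < x) :
    Summable (fun n : ℤ => ‖(-1 : ℝ) ^ n * Real.exp (-Real.pi * (n : ℝ) ^ 2 * x)‖) := by
  simpa using summable_thetaThree hx

theorem thetaFour_eq_cosKernel {x : ℝ} (hx : 0 < x) :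
    thetaFour x = HurwitzZeta.cosKernel ((1 / 2 : ℝ) : UnitAddCircle) x := by
  have h := HurwitzZeta.hasSum_int_cosKernel (1 / 2) hx
  have h2 : HasSum (fun n : ℤ => (((-1 : ℝ) ^ n * Real.exp (-Real.pi * (n : ℝ) ^ 2 * x) : ℝ) : ℂ))
      (HurwitzZeta.cosKernel ((1 / 2 : ℝ) : UnitAddCircle) x : ℂ) := by
    refine h.congr_fun fun n => ?_
    have : (2 : ℂ) * Real.pi * Complex.I * ((1 / 2 : ℝ) : ℂ) * n = n * (Real.pi * Complex.I) := by
      push_cast; ring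
    rw [this, Complex.exp_int_mul, Complex.exp_pi_mul_I]
    push_cast
    rfl
  rw [Complex.hasSum_ofReal] at h2
  exact h2.tsum_eq

theorem thetaThree_pos {x : ℝ} (hx : 0 < x) : 0 < thetaThree x :=
  (summable_thetaThree hx).tsum_pos (fun _ => (Real.exp_pos _).le) 0 (Real.exp_pos _)

theorem thetaThree_one_div {x : ℝ} (hx : 0 < x) :
    thetaThree (1 / x) = Real.sqrt x * thetaThree x := by
  rw [thetaThree_eq_evenKernel hx, thetaThree_eq_evenKernel (one_div_pos.mpr hx),
    HurwitzZeta.evenKernel_functional_equation 0 x, HurwitzZeta.evenKernel_eq_cosKernel_of_zero,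
    ← Real.sqrt_eq_rpow]
  have := (Real.sqrt_pos.mpr hx).ne'
  field_simp

/-- The substitution `(m, n) = (u + v, u - v)` maps `ℤ²` onto the pairs with `m + n` even. -/
theorem tsum_eq_tsum_add_sub {F : ℤ × ℤ → ℝ} (hF : ∀ p : ℤ × ℤ, ¬ Even (p.1 + p.2) → F p = 0) :
    ∑' p, F p = ∑' q : ℤ × ℤ, F (q.1 + q.2, q.1 - q.2) := by
  have hinj : Function.Injective (fun q : ℤ × ℤ => (q.1 + q.2, q.1 - q.2)) := by
    rintro ⟨a, b⟩ ⟨c, d⟩ h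
    simp only [Prod.mk.injEq] at h ⊢
    omega
  refine (hinj.tsum_eq (f := F) fun p hp => ?_).symm
  by_contra hne
  refine hp (hF p fun ⟨u, hu⟩ => hne ⟨(u, p.1 - u), ?_⟩)
  ext <;> simp only <;> omega

theorem neg_one_zpow_mul_of_even {m n : ℤ} (h : Even (m + n)) :
    (-1 : ℝ) ^ m * (-1 : ℝ) ^ n = 1 := by
  rw [← zpow_add₀ (by norm_num), h.neg_one_zpow]

theorem neg_one_zpow_mul_of_not_even {m n : ℤ} (h : ¬ Even (m + n)) :
    (-1 : ℝ) ^ m * (-1 : ℝ) ^ n = -1 := by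
  rw [← zpow_add₀ (by norm_num), (Int.not_even_iff_odd.mp h).neg_one_zpow]

theorem neg_one_zpow_add_of_not_even {m n : ℤ} (h : ¬ Even (m + n)) :
    (-1 : ℝ) ^ m + (-1 : ℝ) ^ n = 0 := by
  rcases Int.even_or_odd m with hm | hm <;> rcases Int.even_or_odd n with hn | hn
  · exact absurd (hm.add hn) h
  · simp [hm.neg_one_zpow, hn.neg_one_zpow]
  · simp [hm.neg_one_zpow, hn.neg_one_zpow]
  · exact absurd (hm.add_odd hn) h

/-- The arithmetic mean step of `θ₃², θ₄²` under `x ↦ 2x`. -/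
theorem thetaThree_sq_add_thetaFour_sq {x : ℝ} (hx : 0 < x) :
    thetaThree x ^ 2 + thetaFour x ^ 2 = 2 * thetaThree (2 * x) ^ 2 := by
  have h3 : Summable fun n : ℤ => ‖Real.exp (-Real.pi * (n : ℝ) ^ 2 * x)‖ :=
    (summable_thetaThree hx).norm
  have h3' : Summable fun n : ℤ => ‖Real.exp (-Real.pi * (n : ℝ) ^ 2 * (2 * x))‖ :=
    (summable_thetaThree (by positivity : 0 < 2 * x)).norm
  have h4 := summable_norm_thetaFour hx
  rw [sq, sq, sq, thetaThree, thetaFour, thetaThree, tsum_mul_tsum_of_summable_norm h3 h3,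
    tsum_mul_tsum_of_summable_norm h4 h4, tsum_mul_tsum_of_summable_norm h3' h3',
    ← (summable_mul_of_summable_norm h3 h3).tsum_add (summable_mul_of_summable_norm h4 h4),
    tsum_eq_tsum_add_sub, ← tsum_mul_left]
  · refine tsum_congr fun q => ?_
    have hs := neg_one_zpow_mul_of_even (m := q.1 + q.2) (n := q.1 - q.2) ⟨q.1, by ring⟩
    rw [mul_mul_mul_comm, hs, ← Real.exp_add, ← Real.exp_add, one_mul, ← two_mul]
    congr 2
    push_cast
    ring
  · intro p hp
    have hs := neg_one_zpow_mul_of_not_even hp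
    rw [mul_mul_mul_comm, hs]
    ring

/-- The geometric mean step of `θ₃², θ₄²` under `x ↦ 2x`. -/
theorem thetaThree_mul_thetaFour {x : ℝ} (hx : 0 < x) :
    thetaThree x * thetaFour x = thetaFour (2 * x) ^ 2 := by
  have h3 : Summable fun n : ℤ => ‖Real.exp (-Real.pi * (n : ℝ) ^ 2 * x)‖ :=
    (summable_thetaThree hx).norm
  have h4' := summable_norm_thetaFour (by positivity : 0 < 2 * x)
  have h4 := summable_norm_thetaFour hx
  -- Symmetrizing the double sum makes the terms with `m + n` odd vanish.
  have key : thetaThree x * thetaFour x + thetaFour x * thetaThree x =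
      2 * thetaFour (2 * x) ^ 2 := by
    rw [sq, thetaThree, thetaFour, thetaFour, tsum_mul_tsum_of_summable_norm h3 h4,
      tsum_mul_tsum_of_summable_norm h4 h3, tsum_mul_tsum_of_summable_norm h4' h4',
      ← (summable_mul_of_summable_norm h3 h4).tsum_add (summable_mul_of_summable_norm h4 h3),
      tsum_eq_tsum_add_sub, ← tsum_mul_left]
    · refine tsum_congr fun q => ?_
      have e1 : (-1 : ℝ) ^ (q.1 + q.2) = (-1 : ℝ) ^ q.1 * (-1 : ℝ) ^ q.2 :=
        zpow_add₀ (by norm_num) _ _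
      have e2 : (-1 : ℝ) ^ (q.1 - q.2) = (-1 : ℝ) ^ q.1 * (-1 : ℝ) ^ q.2 := by
        rw [← e1]
        have := neg_one_zpow_mul_of_even (m := q.1 + q.2) (n := q.1 - q.2) ⟨q.1, by ring⟩
        rcases Int.even_or_odd (q.1 + q.2) with h | h <;> rw [h.neg_one_zpow] at this ⊢ <;> linarith
      have e3 : Real.exp (-Real.pi * ((q.1 + q.2 : ℤ) : ℝ) ^ 2 * x) *
          Real.exp (-Real.pi * ((q.1 - q.2 : ℤ) : ℝ) ^ 2 * x) =
          Real.exp (-Real.pi * (q.1 : ℝ) ^ 2 * (2 * x)) *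
          Real.exp (-Real.pi * (q.2 : ℝ) ^ 2 * (2 * x)) := by
        rw [← Real.exp_add, ← Real.exp_add]
        congr 1
        push_cast
        ring
      rw [e1, e2]
      linear_combination 2 * ((-1 : ℝ) ^ q.1 * (-1 : ℝ) ^ q.2) * e3
    · intro p hp
      linear_combination Real.exp (-Real.pi * (p.1 : ℝ) ^ 2 * x) *
        Real.exp (-Real.pi * (p.2 : ℝ) ^ 2 * x) * neg_one_zpow_add_of_not_even hp
  linarith

/-- Combining the two mean steps at `x = 1/2, 1` with the functional equation `1/2 ↔ 2`. -/
theorem thetaThree_one_sq_sq : (thetaThree 1 ^ 2) ^ 2 = 2 * (thetaFour 1 ^ 2) ^ 2 := by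
  have h1 := thetaThree_sq_add_thetaFour_sq (x := 1 / 2) (by norm_num)
  have h2 := thetaThree_mul_thetaFour (x := 1 / 2) (by norm_num)
  have h3 := thetaThree_sq_add_thetaFour_sq (x := 1) (by norm_num)
  have h4 := thetaThree_one_div (x := 2) (by norm_num)
  norm_num at h1 h2 h3
  have h5 : thetaThree (1 / 2) ^ 2 = 2 * thetaThree 2 ^ 2 := by
    rw [h4, mul_pow, Real.sq_sqrt (by norm_num)]
  rw [← h3] at h5
  have h6 : thetaThree (1 / 2) ^ 2 * thetaFour (1 / 2) ^ 2 = (thetaFour 1 ^ 2) ^ 2 := by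
    rw [← h2]; ring
  have h7 : thetaFour (1 / 2) ^ 2 = thetaThree 1 ^ 2 - thetaFour 1 ^ 2 := by linarith
  rw [h5, h7] at h6
  linarith

theorem tendsto_thetaThree : Filter.Tendsto thetaThree Filter.atTop (nhds 1) := by
  obtain ⟨p, hp, h⟩ := HurwitzZeta.isBigO_atTop_evenKernel_sub 0
  have h0 : Filter.Tendsto (fun x : ℝ => Real.exp (-p * x)) Filter.atTop (nhds 0) := by
    refine Real.tendsto_exp_atBot.comp ?_
    exact Filter.tendsto_id.const_mul_atTop_of_neg (neg_neg_of_pos hp)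
  have h2 := (h.trans_tendsto h0).add_const 1
  simp only [if_true, sub_add_cancel, zero_add] at h2
  refine h2.congr' ?_
  filter_upwards [Filter.eventually_gt_atTop 0] with x hx
  exact (thetaThree_eq_evenKernel hx).symm

theorem tendsto_thetaFour : Filter.Tendsto thetaFour Filter.atTop (nhds 1) := by
  obtain ⟨p, hp, h⟩ := HurwitzZeta.isBigO_atTop_cosKernel_sub ((1 / 2 : ℝ) : UnitAddCircle)
  have h0 : Filter.Tendsto (fun x : ℝ => Real.exp (-p * x)) Filter.atTop (nhds 0) := by
    refine Real.tendsto_exp_atBot.comp ?_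
    exact Filter.tendsto_id.const_mul_atTop_of_neg (neg_neg_of_pos hp)
  have h2 := (h.trans_tendsto h0).add_const 1
  simp only [sub_add_cancel, zero_add] at h2
  refine h2.congr' ?_
  filter_upwards [Filter.eventually_gt_atTop 0] with x hx
  exact (thetaFour_eq_cosKernel hx).symm

/-! ### Gauss's elliptic integral -/

/-- The complete elliptic integral `∫_ℝ dx / √((x² + a²)(x² + b²))`; for `a, b > 0` it equals
`π / M(a, b)`, where `M` is the arithmetic-geometric mean. -/
noncomputable def agmIntegral (a b : ℝ) : ℝ :=
  ∫ x : ℝ, 1 / Real.sqrt ((x ^ 2 + a ^ 2) * (x ^ 2 + b ^ 2))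

/-- The substitution `u = (x - p/x)/2`, a bijection from `(0, ∞)` onto `ℝ`. -/
theorem integral_eq_integral_sub_div {p : ℝ} (hp : 0 < p) (g : ℝ → ℝ) :
    ∫ u : ℝ, g u = ∫ x in Set.Ioi (0 : ℝ), (1 + p / x ^ 2) / 2 * g ((x - p / x) / 2) := by
  have himg : (fun x : ℝ => (x - p / x) / 2) '' Set.Ioi 0 = Set.univ := by
    refine Set.eq_univ_of_forall fun u => ?_
    have h1 : u ^ 2 < u ^ 2 + p := by linarith
    have hs : 0 ≤ u ^ 2 + p := by positivity
    have h2 : 0 < u + Real.sqrt (u ^ 2 + p) := by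
      have := (abs_lt_of_sq_lt_sq (by rwa [Real.sq_sqrt hs]) (Real.sqrt_nonneg _) :
        |u| < Real.sqrt (u ^ 2 + p))
      linarith [neg_abs_le u]
    refine ⟨u + Real.sqrt (u ^ 2 + p), h2, ?_⟩
    have h3 := Real.sq_sqrt hs
    have h4 := h2.ne'
    simp only
    field_simp
    linear_combination h3
  have hinj : Set.InjOn (fun x : ℝ => (x - p / x) / 2) (Set.Ioi 0) := by
    intro x hx y hy h
    have hx' : 0 < x := hx
    have hy' : 0 < y := hy
    simp only at h
    field_simp at h
    have h5 : (x - y) * (x * y + p) = 0 := by linear_combination h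
    have h6 : 0 < x * y + p := by positivity
    rcases mul_eq_zero.mp h5 with h7 | h7 <;> linarith
  have hder : ∀ x ∈ Set.Ioi (0 : ℝ), HasDerivWithinAt (fun x : ℝ => (x - p / x) / 2)
      ((1 + p / x ^ 2) / 2) (Set.Ioi 0) x := by
    intro x hx
    have hx' : x ≠ 0 := (show 0 < x from hx).ne'
    have h := (((hasDerivAt_id x).sub ((hasDerivAt_const x p).div (hasDerivAt_id x) hx')).div_const
      2).hasDerivWithinAt (s := Set.Ioi 0)
    refine h.congr_deriv ?_
    simp only [id]
    field_simp
    ring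
  have h := MeasureTheory.integral_image_eq_integral_abs_deriv_smul measurableSet_Ioi hder hinj g
  rw [himg, MeasureTheory.setIntegral_univ] at h
  rw [h]
  refine MeasureTheory.setIntegral_congr_fun measurableSet_Ioi fun x hx => ?_
  have hx' : 0 < x := hx
  have : 0 < (1 + p / x ^ 2) / 2 := by positivity
  simp [abs_of_pos this]

theorem integral_Ioi_agm {a b : ℝ} :
    2 * ∫ x in Set.Ioi (0 : ℝ), 1 / Real.sqrt ((x ^ 2 + a ^ 2) * (x ^ 2 + b ^ 2)) =
      agmIntegral a b := by
  rw [agmIntegral]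
  have := integral_comp_abs
    (f := fun x : ℝ => 1 / Real.sqrt ((x ^ 2 + a ^ 2) * (x ^ 2 + b ^ 2)))
  simpa only [sq_abs] using this.symm

/-- Gauss's invariance of the elliptic integral under the arithmetic-geometric mean step, by
Newman's substitution `u = (x - ab/x)/2`. -/
theorem agmIntegral_step {a b : ℝ} (ha : 0 < a) (hb : 0 < b) {m : ℝ} (hm : m ^ 2 = a * b) :
    agmIntegral ((a + b) / 2) m = agmIntegral a b := by
  have hp : 0 < a * b := by positivity
  rw [← integral_Ioi_agm (a := a), agmIntegral, integral_eq_integral_sub_div hp,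
    ← MeasureTheory.integral_const_mul]
  refine MeasureTheory.setIntegral_congr_fun measurableSet_Ioi fun x hx => ?_
  have hx' : 0 < x := hx
  have e : (((x - a * b / x) / 2) ^ 2 + ((a + b) / 2) ^ 2) * (((x - a * b / x) / 2) ^ 2 + m ^ 2) =
      ((x ^ 2 + a ^ 2) * (x ^ 2 + b ^ 2)) * ((x + a * b / x) / (4 * x)) ^ 2 := by
    rw [hm]
    field_simp
    ring
  have h1 : 0 < (x + a * b / x) / (4 * x) := by positivity
  have h2 : 0 < Real.sqrt ((x ^ 2 + a ^ 2) * (x ^ 2 + b ^ 2)) := Real.sqrt_pos.mpr (by positivity)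
  rw [e, Real.sqrt_mul (by positivity), Real.sqrt_sq h1.le]
  field_simp
  ring

theorem agmIntegral_self {a : ℝ} (ha : 0 < a) : agmIntegral a a = Real.pi / a := by
  have h : ∀ x : ℝ, 1 / Real.sqrt ((x ^ 2 + a ^ 2) * (x ^ 2 + a ^ 2)) =
      (a ^ 2)⁻¹ * (1 + (x / a) ^ 2)⁻¹ := by
    intro x
    rw [Real.sqrt_mul_self (by positivity)]
    field_simp
    ring
  simp_rw [agmIntegral, h]
  rw [MeasureTheory.integral_const_mul,
    MeasureTheory.Measure.integral_comp_div (fun x : ℝ => (1 + x ^ 2)⁻¹) a,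
    integral_univ_inv_one_add_sq, abs_of_pos ha, smul_eq_mul]
  field_simp

theorem integrable_agmIntegral {a b : ℝ} (ha : 0 < a) (hb : 0 < b) :
    MeasureTheory.Integrable fun x : ℝ =>
      1 / Real.sqrt ((x ^ 2 + a ^ 2) * (x ^ 2 + b ^ 2)) := by
  set m := min a b with hm
  have hm0 : 0 < m := lt_min ha hb
  have hi : MeasureTheory.Integrable fun x : ℝ => (m ^ 2)⁻¹ * (1 + (x / m) ^ 2)⁻¹ :=
    (integrable_inv_one_add_sq.comp_div hm0.ne').const_mul _
  refine hi.mono' (Continuous.aestronglyMeasurable ?_) (Filter.Eventually.of_forall fun x => ?_)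
  · refine continuous_const.div (by fun_prop) fun x => (Real.sqrt_pos.mpr (by positivity)).ne'
  · rw [Real.norm_of_nonneg (by positivity)]
    have e : (m ^ 2)⁻¹ * (1 + (x / m) ^ 2)⁻¹ =
        1 / Real.sqrt ((x ^ 2 + m ^ 2) * (x ^ 2 + m ^ 2)) := by
      rw [Real.sqrt_mul_self (by positivity)]
      field_simp
      ring
    rw [e]
    have h1 : m ≤ a := min_le_left _ _
    have h2 : m ≤ b := min_le_right _ _
    have : 0 < Real.sqrt ((x ^ 2 + m ^ 2) * (x ^ 2 + m ^ 2)) := Real.sqrt_pos.mpr (by positivity)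
    gcongr

theorem agmIntegral_anti {a b a' b' : ℝ} (ha : 0 < a) (hb : 0 < b) (h1 : a ≤ a') (h2 : b ≤ b') :
    agmIntegral a' b' ≤ agmIntegral a b := by
  refine MeasureTheory.integral_mono (integrable_agmIntegral (ha.trans_le h1) (hb.trans_le h2))
    (integrable_agmIntegral ha hb) fun x => ?_
  have : 0 < Real.sqrt ((x ^ 2 + a ^ 2) * (x ^ 2 + b ^ 2)) := Real.sqrt_pos.mpr (by positivity)
  simp only
  gcongr

theorem agmIntegral_mul {a b k : ℝ} (hk : 0 < k) :
    agmIntegral (k * a) (k * b) = agmIntegral a b / k := by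
  have h : ∀ x : ℝ, 1 / Real.sqrt ((x ^ 2 + (k * a) ^ 2) * (x ^ 2 + (k * b) ^ 2)) =
      (k ^ 2)⁻¹ * (1 / Real.sqrt (((x / k) ^ 2 + a ^ 2) * ((x / k) ^ 2 + b ^ 2))) := by
    intro x
    have e : (x ^ 2 + (k * a) ^ 2) * (x ^ 2 + (k * b) ^ 2) =
        (k ^ 2) ^ 2 * (((x / k) ^ 2 + a ^ 2) * ((x / k) ^ 2 + b ^ 2)) := by
      field_simp
    rw [e, Real.sqrt_mul (by positivity), Real.sqrt_sq (by positivity)]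
    field_simp
  simp_rw [agmIntegral, h]
  rw [MeasureTheory.integral_const_mul, MeasureTheory.Measure.integral_comp_div
    (fun x : ℝ => 1 / Real.sqrt ((x ^ 2 + a ^ 2) * (x ^ 2 + b ^ 2))) k, abs_of_pos hk, smul_eq_mul]
  field_simp

/-- The lemniscatic integral, from evaluating `∬ t^{-1/2} e^{-t(1+x⁴)}` in both orders. -/
theorem integral_inv_sqrt_one_add_pow_four :
    Real.sqrt Real.pi * ∫ x in Set.Ioi (0 : ℝ), 1 / Real.sqrt (1 + x ^ 4) =
      Real.Gamma (1 / 4) ^ 2 / 4 := by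
  have hG : 0 < Real.Gamma (1 / 4) := Real.Gamma_pos_of_pos (by norm_num)
  set F : ℝ → ℝ → ℝ := fun x t => t ^ (-(1 / 2) : ℝ) * Real.exp (-((1 + x ^ 4) * t)) with hF
  have hx : ∀ x : ℝ, ∫ t in Set.Ioi (0 : ℝ), F x t =
      Real.sqrt Real.pi * (1 / Real.sqrt (1 + x ^ 4)) := by
    intro x
    have h := Real.integral_rpow_mul_exp_neg_mul_Ioi (a := 1 / 2) (r := 1 + x ^ 4) (by norm_num)
      (by positivity)
    rw [Real.Gamma_one_half_eq, ← Real.sqrt_eq_rpow, Real.sqrt_div zero_le_one, Real.sqrt_one,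
      mul_comm] at h
    rw [← h]
    norm_num [hF]
  have hq : ∀ t ∈ Set.Ioi (0 : ℝ), ∫ x in Set.Ioi (0 : ℝ), F x t =
      Real.Gamma (1 / 4) / 4 * (Real.exp (-t) * t ^ ((1 / 4 : ℝ) - 1)) := by
    intro t ht
    have ht' : 0 < t := ht
    have h := integral_exp_neg_mul_rpow (p := 4) (by norm_num) ht'
    have e : ∀ x : ℝ, F x t = t ^ (-(1 / 2) : ℝ) * Real.exp (-t) * Real.exp (-t * x ^ (4 : ℝ)) := by
      intro x
      simp only [hF]
      rw [mul_assoc, ← Real.exp_add, Real.rpow_ofNat]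
      ring_nf
    simp_rw [e]
    rw [MeasureTheory.integral_const_mul, h, Real.Gamma_add_one (by norm_num)]
    have e2 : t ^ ((1 / 4 : ℝ) - 1) = t ^ (-(1 / 2) : ℝ) * t ^ (-1 / 4 : ℝ) := by
      rw [← Real.rpow_add ht']; norm_num
    rw [e2]
    ring
  have hint : MeasureTheory.Integrable (Function.uncurry F)
      ((MeasureTheory.volume.restrict (Set.Ioi 0)).prod
        (MeasureTheory.volume.restrict (Set.Ioi 0))) := by
    have hmeas : Measurable (Function.uncurry F) := by
      simp only [hF, Function.uncurry_def]
      fun_prop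
    rw [MeasureTheory.integrable_prod_iff' hmeas.aestronglyMeasurable]
    refine ⟨?_, ?_⟩
    · filter_upwards [MeasureTheory.ae_restrict_mem measurableSet_Ioi] with t ht
      have ht' : 0 < t := ht
      refine MeasureTheory.Integrable.of_integral_ne_zero ?_
      simp only [Function.uncurry_apply_pair]
      rw [hq t ht]
      positivity
    · have h := (Real.GammaIntegral_convergent (s := 1 / 4) (by norm_num)).const_mul
        (Real.Gamma (1 / 4) / 4)
      refine h.congr ?_
      filter_upwards [MeasureTheory.ae_restrict_mem measurableSet_Ioi] with t ht
      have ht' : 0 < t := ht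
      simp only [Function.uncurry_apply_pair]
      rw [← hq t ht]
      refine MeasureTheory.integral_congr_ae (Filter.Eventually.of_forall fun x => ?_)
      simp only [hF]
      rw [Real.norm_of_nonneg (by positivity)]
  rw [← MeasureTheory.integral_const_mul]
  simp_rw [← hx]
  rw [MeasureTheory.integral_integral_swap hint,
    MeasureTheory.setIntegral_congr_fun measurableSet_Ioi hq, MeasureTheory.integral_const_mul,
    ← Real.Gamma_eq_integral (by norm_num)]
  ring

/-- The substitution `u = (x - 1/x)/2` turns `(u² + 1/2)(u² + 1)` into a multiple of `x⁴ + 1`. -/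
theorem agmIntegral_lemniscate {r : ℝ} (hr : r ^ 2 = 1 / 2) :
    agmIntegral r 1 = 2 * ∫ x in Set.Ioi (0 : ℝ), 1 / Real.sqrt (1 + x ^ 4) := by
  rw [agmIntegral, integral_eq_integral_sub_div one_pos, ← MeasureTheory.integral_const_mul]
  refine MeasureTheory.setIntegral_congr_fun measurableSet_Ioi fun x hx => ?_
  have hx' : 0 < x := hx
  have e : (((x - 1 / x) / 2) ^ 2 + r ^ 2) * (((x - 1 / x) / 2) ^ 2 + 1 ^ 2) =
      (1 + x ^ 4) * ((x + 1 / x) / (4 * x)) ^ 2 := by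
    rw [hr]
    field_simp
    ring
  have h1 : 0 < (x + 1 / x) / (4 * x) := by positivity
  have h2 : 0 < Real.sqrt (1 + x ^ 4) := Real.sqrt_pos.mpr (by positivity)
  rw [e, Real.sqrt_mul (by positivity), Real.sqrt_sq h1.le]
  field_simp
  ring

/-! ### The value of `θ₃` at `e^{-π}` -/

/-- Along `x = 2^k` the values `θ₃², θ₄²` run through arithmetic-geometric mean steps. -/
theorem agmIntegral_theta_two_pow (h1 : 0 < thetaFour 1) (k : ℕ) :
    0 < thetaFour (2 ^ k) ^ 2 ∧ agmIntegral (thetaThree (2 ^ k) ^ 2) (thetaFour (2 ^ k) ^ 2) =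
      agmIntegral (thetaThree 1 ^ 2) (thetaFour 1 ^ 2) := by
  induction k with
  | zero => exact ⟨by simpa using pow_pos h1 2, by simp⟩
  | succ k ih =>
    have hx : (0 : ℝ) < 2 ^ k := by positivity
    have hA := thetaThree_sq_add_thetaFour_sq hx
    have hB := thetaThree_mul_thetaFour hx
    have h3 := thetaThree_pos hx
    rw [← pow_succ'] at hA hB
    refine ⟨?_, ?_⟩
    · rw [← hB]
      have : thetaFour (2 ^ k) ≠ 0 := fun h => by simp [h] at ih
      have h4 : thetaThree (2 ^ k) * thetaFour (2 ^ k) ≠ 0 := mul_ne_zero h3.ne' this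
      rw [hB] at h4 ⊢
      positivity
    · rw [← ih.2, ← agmIntegral_step (by positivity) ih.1 (m := thetaFour (2 ^ (k + 1)) ^ 2)]
      · congr 1
        linarith
      · rw [← hB]; ring

theorem agmIntegral_theta_one (h1 : 0 < thetaFour 1) :
    agmIntegral (thetaThree 1 ^ 2) (thetaFour 1 ^ 2) = Real.pi := by
  have hpow : Filter.Tendsto (fun k : ℕ => (2 : ℝ) ^ k) Filter.atTop Filter.atTop :=
    tendsto_pow_atTop_atTop_of_one_lt one_lt_two
  have h3 := (tendsto_thetaThree.comp hpow).pow 2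
  have h4 := (tendsto_thetaFour.comp hpow).pow 2
  have hmin := h3.min h4
  have hmax := h3.max h4
  simp only [Function.comp_apply, one_pow, min_self, max_self] at hmin hmax
  have hlo := (tendsto_const_nhds (x := Real.pi)).div hmin one_ne_zero
  have hhi := (tendsto_const_nhds (x := Real.pi)).div hmax one_ne_zero
  rw [div_one] at hlo hhi
  refine le_antisymm (ge_of_tendsto' hlo fun k => ?_) (le_of_tendsto' hhi fun k => ?_)
  · have h := agmIntegral_theta_two_pow h1 k
    have h3 : 0 < thetaThree (2 ^ k) ^ 2 := pow_pos (thetaThree_pos (by positivity)) 2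
    have hm := lt_min h3 h.1
    rw [← h.2, Pi.div_apply, ← agmIntegral_self hm]
    exact agmIntegral_anti hm hm (min_le_left _ _) (min_le_right _ _)
  · have h := agmIntegral_theta_two_pow h1 k
    have h3 : 0 < thetaThree (2 ^ k) ^ 2 := pow_pos (thetaThree_pos (by positivity)) 2
    rw [← h.2, Pi.div_apply, ← agmIntegral_self (h3.trans_le (le_max_left _ _))]
    exact agmIntegral_anti h3 h.1 (le_max_left _ _) (le_max_right _ _)

/-- The classical evaluation `θ₃(e^{-π}) = π^{1/4} / Γ(3/4)`. -/
theorem thetaThree_one : thetaThree 1 = Real.pi ^ (1 / 4 : ℝ) / Real.Gamma (3 / 4) := by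
  have h3 := thetaThree_pos one_pos
  have hAB := thetaThree_one_sq_sq
  have h4 : 0 < thetaFour 1 := by
    have h := thetaThree_mul_thetaFour (x := 1) one_pos
    have hne : thetaFour 1 ≠ 0 := fun h0 => by
      rw [h0] at hAB; simp [h3.ne'] at hAB
    have h5 : 0 ≤ thetaThree 1 * thetaFour 1 := by rw [h]; positivity
    exact lt_of_le_of_ne (nonneg_of_mul_nonneg_right h5 h3) hne.symm
  set A := thetaThree 1 ^ 2 with hA
  set B := thetaFour 1 ^ 2 with hB
  have hA0 : 0 < A := by positivity
  have hr : (B / A) ^ 2 = 1 / 2 := by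
    field_simp
    linarith
  have hpi := agmIntegral_theta_one h4
  rw [← hA, ← hB] at hpi
  have hsw : agmIntegral A B = agmIntegral (A * (B / A)) (A * 1) := by
    rw [mul_div_cancel₀ _ hA0.ne', mul_one, agmIntegral, agmIntegral]
    simp_rw [mul_comm]
  rw [hsw, agmIntegral_mul hA0, agmIntegral_lemniscate hr] at hpi
  have hlem := integral_inv_sqrt_one_add_pow_four
  set L := ∫ x in Set.Ioi (0 : ℝ), 1 / Real.sqrt (1 + x ^ 4)
  have hsp : 0 < Real.sqrt Real.pi := Real.sqrt_pos.mpr Real.pi_pos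
  have hsp2 := Real.sq_sqrt Real.pi_pos.le
  have hs2 := Real.sq_sqrt (show (0 : ℝ) ≤ 2 by norm_num)
  have hs20 : 0 < Real.sqrt 2 := by positivity
  have hG1 : 0 < Real.Gamma (1 / 4) := Real.Gamma_pos_of_pos (by norm_num)
  have hG3 : 0 < Real.Gamma (3 / 4) := Real.Gamma_pos_of_pos (by norm_num)
  have hrefl : Real.Gamma (1 / 4) * Real.Gamma (3 / 4) = Real.pi * Real.sqrt 2 := by
    have h := Real.Gamma_mul_Gamma_one_sub (1 / 4)
    rw [mul_one_div, Real.sin_pi_div_four] at h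
    norm_num at h
    rw [h]
    field_simp
    linarith
  rw [div_eq_iff hA0.ne'] at hpi
  have hG1e : Real.Gamma (1 / 4) = Real.pi * Real.sqrt 2 / Real.Gamma (3 / 4) := by
    rw [eq_div_iff hG3.ne', hrefl]
  rw [hG1e, div_pow, mul_pow, hs2] at hlem
  have hAeq : A = (Real.pi ^ (1 / 4 : ℝ) / Real.Gamma (3 / 4)) ^ 2 := by
    have hq : (Real.pi ^ (1 / 4 : ℝ)) ^ 2 = Real.sqrt Real.pi := by
      rw [← Real.rpow_natCast, ← Real.rpow_mul Real.pi_pos.le, Real.sqrt_eq_rpow]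
      norm_num
    rw [div_pow, hq]
    have : Real.sqrt Real.pi * (Real.pi * A) = Real.pi ^ 2 / Real.Gamma (3 / 4) ^ 2 := by
      rw [← hpi]; linear_combination 2 * hlem
    rw [eq_div_iff (by positivity)]
    rw [eq_div_iff (by positivity)] at this
    have h6 : (Real.sqrt Real.pi * Real.pi) * (A * Real.Gamma (3 / 4) ^ 2) =
        (Real.sqrt Real.pi * Real.pi) * Real.sqrt Real.pi := by
      linear_combination this - Real.pi * hsp2
    exact mul_left_cancel₀ (by positivity) h6
  exact (pow_left_inj₀ h3.le (by positivity) two_ne_zero).mp hAeq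

/-! ### The entire `ξ`-function -/

/-- The entire function `½ t(t-1) Λ₀(t) + ½`, where `Λ₀` is the completed zeta function with its
two poles removed.  It extends `xi` over the removable singularities of the formula for `xi`. -/
noncomputable def riemannXi (t : ℂ) : ℂ := t * (t - 1) / 2 * completedRiemannZeta₀ t + 1 / 2

theorem differentiable_riemannXi : Differentiable ℂ riemannXi := by
  have := differentiable_completedZeta₀
  unfold riemannXi
  fun_prop

theorem riemannXi_one_sub (t : ℂ) : riemannXi (1 - t) = riemannXi t := by
  rw [riemannXi, riemannXi, completedRiemannZeta₀_one_sub]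
  ring

theorem riemannXi_zero : riemannXi 0 = 1 / 2 := by simp [riemannXi]

theorem xi_eq_riemannXi {t : ℂ} (h0 : 0 < t.re) (h1 : t ≠ 1) : xi t = riemannXi t := by
  have hG : Complex.Gamma (1 + t / 2) ≠ 0 := Complex.Gamma_ne_zero_of_re_pos (by
    simp only [Complex.add_re, Complex.one_re, Complex.div_ofNat_re]; linarith)
  have hp : (Real.pi : ℂ) ^ (-t / 2) ≠ 0 := by
    simp [Complex.cpow_eq_zero_iff, Real.pi_ne_zero]
  have h1' : 1 - t ≠ 0 := sub_ne_zero.mpr h1.symm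
  rw [xi, riemannXi, riemannZeta_eq_mul_completedRiemannZeta₀, add_comm (t / 2) 1]
  generalize Complex.Gamma (1 + t / 2) = G at *
  field_simp
  ring

theorem riemannXi_eq_mul_completedRiemannZeta {t : ℂ} (h0 : t ≠ 0) (h1 : t ≠ 1) :
    riemannXi t = t * (t - 1) / 2 * completedRiemannZeta t := by
  have h1' : 1 - t ≠ 0 := sub_ne_zero.mpr h1.symm
  rw [riemannXi, completedRiemannZeta_eq]
  field_simp
  ring

/-! ### Growth of `ξ` in vertical strips and decay to the right of the critical strip -/

/-- A Mellin transform is bounded on a closed vertical strip on whose edges it converges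
absolutely. -/
theorem exists_norm_mellin_le {f : ℝ → ℂ} {a b : ℝ} (ha : MellinConvergent f a)
    (hb : MellinConvergent f b) :
    ∃ C, ∀ s : ℂ, a ≤ s.re → s.re ≤ b → ‖mellin f s‖ ≤ C := by
  refine ⟨_, fun s hsa hsb => MeasureTheory.norm_integral_le_of_norm_le
    (MeasureTheory.Integrable.add ha.norm hb.norm) ?_⟩
  filter_upwards [MeasureTheory.ae_restrict_mem measurableSet_Ioi] with x hx
  have hx' : 0 < x := hx
  simp only [norm_smul, Complex.norm_cpow_eq_rpow_re_of_pos hx', Complex.sub_re, Complex.one_re,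
    Complex.ofReal_re, Pi.add_apply, ← add_mul]
  refine mul_le_mul_of_nonneg_right ?_ (norm_nonneg _)
  rcases le_total 1 x with h | h
  · have h2 := Real.rpow_le_rpow_of_exponent_le h (sub_le_sub_right hsb 1)
    have h3 := Real.rpow_nonneg hx'.le (a - 1)
    linarith
  · have h2 := Real.rpow_le_rpow_of_exponent_ge hx' h (sub_le_sub_right hsa 1)
    have h3 := Real.rpow_nonneg hx'.le (b - 1)
    linarith

theorem exists_norm_completedRiemannZeta₀_le (a b : ℝ) :
    ∃ C, ∀ t : ℂ, a ≤ t.re → t.re ≤ b → ‖completedRiemannZeta₀ t‖ ≤ C := by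
  have hc : ∀ x : ℝ, MellinConvergent (HurwitzZeta.hurwitzEvenFEPair 0).f_modif (x : ℂ) := fun x =>
    ((HurwitzZeta.hurwitzEvenFEPair 0).isStrongFEPair_toStrongFEPair.hasMellin x).1
  obtain ⟨C, hC⟩ := exists_norm_mellin_le (hc (a / 2)) (hc (b / 2))
  refine ⟨C / 2, fun t hta htb => ?_⟩
  have h := hC (t / 2) (by rw [Complex.div_ofNat_re]; linarith)
    (by rw [Complex.div_ofNat_re]; linarith)
  rw [completedRiemannZeta₀, HurwitzZeta.completedHurwitzZetaEven₀, norm_div, Complex.norm_ofNat]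
  exact div_le_div_of_nonneg_right h zero_le_two

theorem exists_norm_riemannXi_le (a b : ℝ) :
    ∃ C, ∀ t : ℂ, a ≤ t.re → t.re ≤ b → ‖riemannXi t‖ ≤ C * (1 + t.im ^ 2) := by
  obtain ⟨C, hC⟩ := exists_norm_completedRiemannZeta₀_le a b
  set M := 1 + |a| + |b| with hM
  have hM1 : 1 ≤ M := by rw [hM]; linarith [abs_nonneg a, abs_nonneg b]
  refine ⟨(M + 1) ^ 2 * |C| + 1, fun t hta htb => ?_⟩
  have hre : |t.re| ≤ M := by
    rw [abs_le]; constructor <;> linarith [neg_abs_le a, le_abs_self b, abs_nonneg a, abs_nonneg b]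
  have h1 : ‖t‖ ≤ M + |t.im| := (Complex.norm_le_abs_re_add_abs_im t).trans (by linarith)
  have h2 : ‖t - 1‖ ≤ M + 1 + |t.im| := (norm_sub_le t 1).trans (by rw [norm_one]; linarith)
  have h3 : ‖t * (t - 1)‖ ≤ 2 * ((M + 1) ^ 2 * (1 + t.im ^ 2)) := by
    rw [norm_mul]
    calc ‖t‖ * ‖t - 1‖ ≤ (M + |t.im|) * (M + 1 + |t.im|) := by gcongr
      _ ≤ 2 * ((M + 1) ^ 2 * (1 + t.im ^ 2)) := by
        have h := abs_nonneg t.im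
        have hs := sq_abs t.im
        nlinarith [sq_nonneg (M + 1 - |t.im|), mul_nonneg (by linarith : 0 ≤ M) (sq_nonneg t.im),
          mul_nonneg (sq_nonneg M) (sq_nonneg t.im)]
  have h4 : ‖completedRiemannZeta₀ t‖ ≤ |C| := (hC t hta htb).trans (le_abs_self C)
  calc ‖riemannXi t‖ ≤ ‖t * (t - 1) / 2 * completedRiemannZeta₀ t‖ + ‖(1 / 2 : ℂ)‖ :=
        norm_add_le _ _
    _ ≤ ((M + 1) ^ 2 * (1 + t.im ^ 2)) * |C| + 1 * (1 + t.im ^ 2) := by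
        refine add_le_add ?_ ?_
        · rw [norm_mul, norm_div, Complex.norm_ofNat]
          refine mul_le_mul ?_ h4 (norm_nonneg _) (by positivity)
          linarith
        · norm_num
          nlinarith [sq_nonneg t.im]
    _ = ((M + 1) ^ 2 * |C| + 1) * (1 + t.im ^ 2) := by ring

theorem norm_Gamma_le {z : ℂ} (hz : 0 < z.re) : ‖Complex.Gamma z‖ ≤ Real.Gamma z.re := by
  rw [Complex.Gamma_eq_integral hz, Real.Gamma_eq_integral hz, Complex.GammaIntegral]
  refine MeasureTheory.norm_integral_le_of_norm_le (Real.GammaIntegral_convergent hz) ?_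
  filter_upwards [MeasureTheory.ae_restrict_mem measurableSet_Ioi] with x hx
  have hx' : 0 < x := hx
  rw [norm_mul, Complex.norm_real, Real.norm_of_nonneg (Real.exp_pos _).le,
    Complex.norm_cpow_eq_rpow_re_of_pos hx', Complex.sub_re, Complex.one_re]

/-- Cubic decay of `Γ` along vertical lines, obtained from three shifts `Γ(z + 1) = z Γ(z)`. -/
theorem norm_Gamma_mul_norm_pow_le {z : ℂ} (hz : 0 < z.re) :
    ‖Complex.Gamma z‖ * ‖z‖ ^ 3 ≤ Real.Gamma (z.re + 3) := by
  have hne : ∀ k : ℝ, 0 ≤ k → z + k ≠ 0 := fun k hk h => by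
    have := congrArg Complex.re h
    simp only [Complex.add_re, Complex.ofReal_re, Complex.zero_re] at this
    linarith
  have hle : ∀ k : ℝ, 0 ≤ k → ‖z‖ ≤ ‖z + k‖ := fun k hk => by
    rw [Complex.norm_def, Complex.norm_def, Complex.normSq_apply, Complex.normSq_apply]
    simp only [Complex.add_re, Complex.ofReal_re, Complex.add_im, Complex.ofReal_im, add_zero]
    gcongr <;> linarith
  have h0 := hne 0 le_rfl
  have h1 := hne 1 zero_le_one
  have h2 := hne 2 zero_le_two
  push_cast at h0 h1 h2
  rw [add_zero] at h0
  have hl1 := hle 1 zero_le_one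
  have hl2 := hle 2 zero_le_two
  push_cast at hl1 hl2
  have e : Complex.Gamma (z + 3) = (z + 2) * ((z + 1) * (z * Complex.Gamma z)) := by
    rw [← Complex.Gamma_add_one z h0, ← Complex.Gamma_add_one (z + 1) h1,
      show z + 1 + 1 = z + 2 by ring, ← Complex.Gamma_add_one (z + 2) h2]
    ring_nf
  have h := norm_Gamma_le (z := z + 3) (by
    simp only [Complex.add_re, Complex.re_ofNat]; linarith)
  rw [e, norm_mul, norm_mul, norm_mul, Complex.add_re, Complex.re_ofNat] at h
  refine le_trans ?_ h
  calc ‖Complex.Gamma z‖ * ‖z‖ ^ 3 = ‖z‖ * (‖z‖ * (‖z‖ * ‖Complex.Gamma z‖)) := by ring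
    _ ≤ ‖z + 2‖ * (‖z + 1‖ * (‖z‖ * ‖Complex.Gamma z‖)) := by gcongr

/-- On a line to the right of `Re t = 1` the Dirichlet series bounds `ζ` uniformly. -/
theorem exists_norm_riemannZeta_le {c : ℝ} (hc : 1 < c) :
    ∃ C, ∀ t : ℂ, t.re = c → ‖riemannZeta t‖ ≤ C := by
  refine ⟨∑' n : ℕ, 1 / (n : ℝ) ^ c, fun t ht => ?_⟩
  rw [zeta_eq_tsum_one_div_nat_cpow (ht ▸ hc)]
  refine tsum_of_norm_bounded (Real.summable_one_div_nat_rpow.mpr hc).hasSum fun n => ?_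
  rw [norm_div, norm_one, Complex.norm_natCast_cpow_of_re_ne_zero _ (by rw [ht]; linarith), ht]

/-- Quadratic decay of `ξ` on a vertical line to the right of the critical strip. -/
theorem exists_norm_riemannXi_vertical_le {c : ℝ} (hc : 1 < c) :
    ∃ C, ∀ y : ℝ, ‖riemannXi (c + y * Complex.I)‖ ≤ C * (1 + y ^ 2)⁻¹ := by
  obtain ⟨Z, hZ⟩ := exists_norm_riemannZeta_le hc
  refine ⟨20 * Real.pi ^ (-c / 2) * Real.Gamma (1 + c / 2 + 3) * Z, fun y => ?_⟩
  set t : ℂ := c + y * Complex.I with ht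
  have hre : t.re = c := by simp [ht]
  have him : t.im = y := by simp [ht]
  have ht1 : t ≠ 1 := fun h => by
    rw [h, Complex.one_re] at hre; linarith
  rw [← xi_eq_riemannXi (by rw [hre]; linarith) ht1, xi, norm_mul, norm_mul, norm_mul]
  set z : ℂ := 1 + t / 2 with hz
  have hzre : z.re = 1 + c / 2 := by rw [hz, Complex.add_re, Complex.div_ofNat_re, hre]; simp
  have hzim : z.im = y / 2 := by rw [hz, Complex.add_im, Complex.div_ofNat_im, him]; simp
  have hz1 : 1 ≤ ‖z‖ := by
    have := Complex.abs_re_le_norm z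
    rw [hzre, abs_of_pos (by linarith)] at this
    linarith
  have hz2 : (1 + y ^ 2) / 4 ≤ ‖z‖ ^ 2 := by
    rw [← Complex.normSq_eq_norm_sq, Complex.normSq_apply, hzre, hzim]
    nlinarith
  have hz3 : ‖t - 1‖ ≤ 5 * ‖z‖ := by
    have : t - 1 = 2 * z - 3 := by rw [hz]; ring
    rw [this]
    refine (norm_sub_le _ _).trans ?_
    rw [norm_mul, Complex.norm_ofNat, Complex.norm_ofNat]
    linarith
  have hG := norm_Gamma_mul_norm_pow_le (z := z) (by rw [hzre]; linarith)
  rw [hzre] at hG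
  have hpi : ‖(Real.pi : ℂ) ^ (-t / 2)‖ = Real.pi ^ (-c / 2) := by
    rw [Complex.norm_cpow_eq_rpow_re_of_pos Real.pi_pos, Complex.div_ofNat_re, Complex.neg_re, hre]
  have hZ0 := hZ t hre
  have hp0 : 0 < Real.pi ^ (-c / 2) := Real.rpow_pos_of_pos Real.pi_pos _
  have hG0 : 0 ≤ Real.Gamma (1 + c / 2 + 3) := (Real.Gamma_pos_of_pos (by linarith)).le
  have key : ‖t - 1‖ * ‖Complex.Gamma z‖ * (1 + y ^ 2) ≤ 20 * Real.Gamma (1 + c / 2 + 3) := by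
    calc ‖t - 1‖ * ‖Complex.Gamma z‖ * (1 + y ^ 2)
        ≤ (5 * ‖z‖) * ‖Complex.Gamma z‖ * (4 * ‖z‖ ^ 2) := by gcongr; linarith
      _ = 20 * (‖Complex.Gamma z‖ * ‖z‖ ^ 3) := by ring
      _ ≤ _ := by gcongr
  rw [hpi, ← div_eq_mul_inv, le_div_iff₀ (by positivity)]
  calc ‖t - 1‖ * Real.pi ^ (-c / 2) * ‖Complex.Gamma z‖ * ‖riemannZeta t‖ * (1 + y ^ 2)
      = Real.pi ^ (-c / 2) * (‖t - 1‖ * ‖Complex.Gamma z‖ * (1 + y ^ 2)) * ‖riemannZeta t‖ := by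
        ring
    _ ≤ Real.pi ^ (-c / 2) * (20 * Real.Gamma (1 + c / 2 + 3)) * Z := by gcongr
    _ = _ := by ring

theorem add_mul_I_sub_ne_zero {c : ℝ} {p : ℂ} (hp : p.re ≠ c) (y : ℝ) :
    (c : ℂ) + y * Complex.I - p ≠ 0 := fun h => by
  have := congrArg Complex.re h
  simp only [Complex.sub_re, Complex.add_re, Complex.ofReal_re, Complex.mul_re, Complex.I_re,
    Complex.ofReal_im, Complex.I_im, Complex.zero_re] at this
  exact hp (by linarith)

theorem abs_sub_le_norm_add_mul_I_sub (c : ℝ) (p : ℂ) (y : ℝ) :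
    |c - p.re| ≤ ‖(c : ℂ) + y * Complex.I - p‖ := by
  simpa using Complex.abs_re_le_norm ((c : ℂ) + y * Complex.I - p)

theorem integrable_vertical_div_sub {F : ℂ → ℂ} (hF : Continuous F) {c : ℝ} {C : ℝ}
    (hC : ∀ y : ℝ, ‖F (c + y * Complex.I)‖ ≤ C * (1 + y ^ 2)⁻¹) {p : ℂ} (hp : p.re ≠ c) :
    MeasureTheory.Integrable fun y : ℝ => F (c + y * Complex.I) / (c + y * Complex.I - p) := by
  have h0 : 0 < |c - p.re| := abs_pos.mpr (sub_ne_zero.mpr hp.symm)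
  refine (((integrable_inv_one_add_sq.const_mul C).div_const |c - p.re|)).mono'
    (Continuous.aestronglyMeasurable ?_) (Filter.Eventually.of_forall fun y => ?_)
  · exact (by fun_prop : Continuous fun y : ℝ => F (c + y * Complex.I)).div (by fun_prop)
      (add_mul_I_sub_ne_zero hp)
  · rw [norm_div]
    exact div_le_div₀ ((norm_nonneg _).trans (hC y)) (hC y) h0 (abs_sub_le_norm_add_mul_I_sub c p y)

theorem integrable_riemannXi_div_sub {c : ℝ} (hc : 1 < c) {p : ℂ} (hp : p.re ≠ c) :
    MeasureTheory.Integrable fun y : ℝ =>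
      riemannXi (c + y * Complex.I) / (c + y * Complex.I - p) := by
  obtain ⟨C, hC⟩ := exists_norm_riemannXi_vertical_le hc
  exact integrable_vertical_div_sub differentiable_riemannXi.continuous hC hp

/-! ### The vertical integral of the completed zeta function -/

theorem completedRiemannZeta_vertical {c : ℝ} (hc : 1 < c) (y : ℝ) :
    completedRiemannZeta (c + y * Complex.I) =
      2 * (riemannXi (c + y * Complex.I) / (c + y * Complex.I - 1) -
        riemannXi (c + y * Complex.I) / (c + y * Complex.I - 0)) := by
  have h0 := add_mul_I_sub_ne_zero (c := c) (p := 0) (by rw [Complex.zero_re]; linarith) y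
  have h1 := add_mul_I_sub_ne_zero (c := c) (p := 1) (by rw [Complex.one_re]; linarith) y
  rw [sub_zero] at h0 ⊢
  rw [riemannXi_eq_mul_completedRiemannZeta h0 (sub_ne_zero.mp h1)]
  field_simp
  ring

/-- Mellin inversion at `x = 1` for `Λ(2s)`, the Mellin transform of `(θ₃(x) - 1) / 2`. -/
theorem integral_completedRiemannZeta_vertical {c : ℝ} (hc : 1 < c) :
    ∫ y : ℝ, completedRiemannZeta (c + y * Complex.I) = 2 * Real.pi * (thetaThree 1 - 1) := by
  set P := HurwitzZeta.hurwitzEvenFEPair 0 with hP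
  have hΛ : ∀ y : ℝ, mellin (fun x => P.f x - P.f₀) ((c / 2 : ℝ) + y * Complex.I) =
      2 * completedRiemannZeta (c + (2 * y : ℝ) * Complex.I) := by
    intro y
    have hre : P.k < (((c / 2 : ℝ) : ℂ) + y * Complex.I).re := by
      simp only [hP, HurwitzZeta.hurwitzEvenFEPair, Complex.add_re, Complex.ofReal_re,
        Complex.mul_re, Complex.I_re, Complex.ofReal_im, Complex.I_im]
      linarith
    rw [(P.hasMellin hre).2, completedRiemannZeta, HurwitzZeta.completedHurwitzZetaEven, ← hP,
      mul_div_cancel₀ _ two_ne_zero]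
    congr 1
    push_cast
    ring
  have hint : MeasureTheory.Integrable fun y : ℝ =>
      completedRiemannZeta (c + y * Complex.I) := by
    simp_rw [completedRiemannZeta_vertical hc]
    exact ((integrable_riemannXi_div_sub hc (by rw [Complex.one_re]; linarith)).sub
      (integrable_riemannXi_div_sub hc (by rw [Complex.zero_re]; linarith))).const_mul 2
  have hk : P.k < (((c / 2 : ℝ) : ℂ)).re := by
    simp only [hP, HurwitzZeta.hurwitzEvenFEPair, Complex.ofReal_re]
    linarith
  have hcont : ContinuousAt (fun x => P.f x - P.f₀) 1 := by
    have h := (HurwitzZeta.continuousOn_evenKernel 0).continuousAt (Ioi_mem_nhds one_pos)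
    simp only [hP, HurwitzZeta.hurwitzEvenFEPair, Function.comp_apply]
    exact (Complex.continuous_ofReal.continuousAt.comp h).sub continuousAt_const
  have hvert : Complex.VerticalIntegrable (mellin fun x => P.f x - P.f₀) (c / 2) := by
    rw [Complex.VerticalIntegrable]
    simp_rw [hΛ]
    exact (hint.comp_mul_left' two_ne_zero).const_mul 2
  have h := mellinInv_mellin_eq (c / 2) (fun x => P.f x - P.f₀) one_pos (P.hasMellin hk).1 hvert
    hcont
  rw [mellinInv] at h
  simp_rw [hΛ, Complex.ofReal_one, Complex.one_cpow, one_smul] at h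
  rw [MeasureTheory.integral_const_mul, MeasureTheory.Measure.integral_comp_mul_left
    (fun y : ℝ => completedRiemannZeta (c + y * Complex.I)) 2] at h
  have hf : P.f 1 - P.f₀ = thetaThree 1 - 1 := by
    simp [hP, HurwitzZeta.hurwitzEvenFEPair, thetaThree_eq_evenKernel one_pos]
  rw [hf] at h
  have hpi : (Real.pi : ℂ) ≠ 0 := Complex.ofReal_ne_zero.mpr Real.pi_ne_zero
  rw [← h]
  generalize ∫ y : ℝ, completedRiemannZeta (c + y * Complex.I) = I
  norm_num [Complex.real_smul]
  field_simp

open Filter Topology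

/-! ### A Cauchy formula for functions symmetric under `t ↦ 1 - t` -/

/-- The principal value of `∫ dy / (a + iy)` is `π` or `-π` according to the sign of `a`. -/
theorem tendsto_integral_inv_add_mul_I {a : ℝ} (ha : a ≠ 0) :
    Tendsto (fun T : ℝ => ∫ y in (-T)..T, 1 / ((a : ℂ) + y * Complex.I)) atTop
      (𝓝 ((Real.pi * (|a| / a) : ℝ) : ℂ)) := by
  have hne : ∀ y : ℝ, (a : ℂ) + y * Complex.I ≠ 0 := fun y => by
    simpa using add_mul_I_sub_ne_zero (c := a) (p := 0) (by simpa using ha.symm) y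
  have hcont : Continuous fun y : ℝ => 1 / ((a : ℂ) + y * Complex.I) :=
    continuous_const.div (by fun_prop) hne
  have hcont' : Continuous fun y : ℝ => 1 / ((a : ℂ) + (-y : ℝ) * Complex.I) :=
    hcont.comp continuous_neg
  -- Only the even part of the integrand contributes.
  have hsymm : ∀ T : ℝ, ∫ y in (-T)..T, 1 / ((a : ℂ) + y * Complex.I) =
      ((∫ y in (-T)..T, a⁻¹ * (1 + (y / a) ^ 2)⁻¹ : ℝ) : ℂ) := by
    intro T
    have h1 : ∫ y in (-T)..T, 1 / ((a : ℂ) + (-y : ℝ) * Complex.I) =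
        ∫ y in (-T)..T, 1 / ((a : ℂ) + y * Complex.I) := by
      rw [intervalIntegral.integral_comp_neg (fun y : ℝ => 1 / ((a : ℂ) + y * Complex.I)), neg_neg]
    have h2 : (∫ y in (-T)..T, 1 / ((a : ℂ) + y * Complex.I)) +
        ∫ y in (-T)..T, 1 / ((a : ℂ) + (-y : ℝ) * Complex.I) =
        2 * ((∫ y in (-T)..T, a⁻¹ * (1 + (y / a) ^ 2)⁻¹ : ℝ) : ℂ) := by
      rw [← intervalIntegral.integral_add (hcont.intervalIntegrable _ _)
        (hcont'.intervalIntegrable _ _), ← intervalIntegral.integral_ofReal,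
        ← intervalIntegral.integral_const_mul]
      refine intervalIntegral.integral_congr fun y _ => ?_
      have h3 := hne y
      have h4 := hne (-y)
      have h5 : (a : ℂ) ≠ 0 := Complex.ofReal_ne_zero.mpr ha
      have h6 : (a : ℂ) ^ 2 + (y : ℂ) ^ 2 ≠ 0 := by
        have : (a : ℂ) ^ 2 + (y : ℂ) ^ 2 =
            ((a : ℂ) + y * Complex.I) * ((a : ℂ) + (-y : ℝ) * Complex.I) := by
          push_cast
          linear_combination (y : ℂ) ^ 2 * Complex.I_sq
        rw [this]
        exact mul_ne_zero h3 h4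
      push_cast at h4 ⊢
      have h7 : (1 : ℂ) + ((y : ℂ) / a) ^ 2 ≠ 0 := by
        have : (1 : ℂ) + ((y : ℂ) / a) ^ 2 = ((a : ℂ) ^ 2 + (y : ℂ) ^ 2) / (a : ℂ) ^ 2 := by
            field_simp
        rw [this]
        exact div_ne_zero h6 (pow_ne_zero 2 h5)
      have h8 : (a : ℂ)⁻¹ * (1 + ((y : ℂ) / a) ^ 2)⁻¹ = a / ((a : ℂ) ^ 2 + (y : ℂ) ^ 2) := by
        field_simp
      rw [h8, div_add_div _ _ h3 h4, mul_div_assoc', div_eq_div_iff (mul_ne_zero h3 h4) h6]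
      linear_combination (2 * a * (y : ℂ) ^ 2) * Complex.I_sq
    rw [h1] at h2
    linear_combination h2 / 2
  simp_rw [hsymm]
  refine (Complex.continuous_ofReal.tendsto _).comp ?_
  have hi : MeasureTheory.Integrable fun y : ℝ => a⁻¹ * (1 + (y / a) ^ 2)⁻¹ :=
    (integrable_inv_one_add_sq.comp_div ha).const_mul _
  have h := MeasureTheory.intervalIntegral_tendsto_integral hi tendsto_neg_atTop_atBot tendsto_id
  rw [MeasureTheory.integral_const_mul,
    MeasureTheory.Measure.integral_comp_div (fun x : ℝ => (1 + x ^ 2)⁻¹) a,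
    integral_univ_inv_one_add_sq, smul_eq_mul] at h
  rwa [show Real.pi * (|a| / a) = a⁻¹ * (|a| * Real.pi) by ring]

theorem differentiable_dslope {F : ℂ → ℂ} (hF : Differentiable ℂ F) (s : ℂ) :
    Differentiable ℂ (dslope F s) := by
  rw [← differentiableOn_univ, Complex.differentiableOn_dslope univ_mem]
  exact hF.differentiableOn

/-- Vertical integrals of the difference quotient `(F(t) - F(s)) / (t - s)`. The truncation is
symmetric about the height `Im s`, since the part with `F(s)` converges only as a principal value. -/
theorem tendsto_integral_dslope {F : ℂ → ℂ} {s : ℂ} {x : ℝ} (hx : s.re ≠ x)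
    (hi : MeasureTheory.Integrable fun y : ℝ => F (x + y * Complex.I) / (x + y * Complex.I - s)) :
    Tendsto (fun T : ℝ => ∫ y in (s.im - T)..(s.im + T), dslope F s (x + y * Complex.I)) atTop
      (𝓝 ((∫ y : ℝ, F (x + y * Complex.I) / (x + y * Complex.I - s)) -
        F s * (Real.pi * (|x - s.re| / (x - s.re)) : ℝ))) := by
  have hne := add_mul_I_sub_ne_zero hx
  have hcont : Continuous fun y : ℝ => 1 / ((x : ℂ) + y * Complex.I - s) :=
    continuous_const.div (by fun_prop) hne
  have h1 : Tendsto (fun T : ℝ => ∫ y in (s.im - T)..(s.im + T),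
      F (x + y * Complex.I) / (x + y * Complex.I - s)) atTop
      (𝓝 (∫ y : ℝ, F (x + y * Complex.I) / (x + y * Complex.I - s))) :=
    MeasureTheory.intervalIntegral_tendsto_integral hi
      (tendsto_atBot_add_const_left _ s.im tendsto_neg_atTop_atBot)
      (tendsto_atTop_add_const_left _ s.im tendsto_id)
  have h2 := tendsto_integral_inv_add_mul_I (a := x - s.re) (sub_ne_zero.mpr hx.symm)
  refine (h1.sub (h2.const_mul (F s))).congr fun T => ?_
  have h3 : ∫ y in (-T)..T, 1 / (((x - s.re : ℝ) : ℂ) + y * Complex.I) =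
      ∫ y in (s.im - T)..(s.im + T), 1 / ((x : ℂ) + y * Complex.I - s) := by
    have h := intervalIntegral.integral_comp_add_right (a := -T) (b := T)
      (fun y : ℝ => 1 / ((x : ℂ) + y * Complex.I - s)) s.im
    rw [show -T + s.im = s.im - T by ring, add_comm T] at h
    rw [← h]
    refine intervalIntegral.integral_congr fun y _ => ?_
    congr 1
    push_cast
    linear_combination -Complex.re_add_im s
  rw [h3, ← intervalIntegral.integral_const_mul,
    ← intervalIntegral.integral_sub hi.intervalIntegrable
      ((hcont.intervalIntegrable _ _).const_mul _)]
  refine intervalIntegral.integral_congr fun y _ => ?_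
  rw [dslope_of_ne F (sub_ne_zero.mp (hne y)), slope_def_field]
  ring

/-- Moving the line of integration across a simple pole. -/
theorem integral_vertical_sub_integral_vertical {F : ℂ → ℂ} (hF : Differentiable ℂ F) {a b C : ℝ}
    (hC : ∀ t : ℂ, a ≤ t.re → t.re ≤ b → ‖F t‖ ≤ C * (1 + t.im ^ 2)⁻¹) {s : ℂ}
    (ha : a < s.re) (hb : s.re < b) :
    (∫ y : ℝ, F (b + y * Complex.I) / (b + y * Complex.I - s)) -
      ∫ y : ℝ, F (a + y * Complex.I) / (a + y * Complex.I - s) = 2 * Real.pi * F s := by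
  have hline : ∀ x : ℝ, a ≤ x → x ≤ b → ∀ y : ℝ,
      ‖F (x + y * Complex.I)‖ ≤ C * (1 + y ^ 2)⁻¹ := fun x hxa hxb y => by
    simpa using hC (x + y * Complex.I) (by simpa using hxa) (by simpa using hxb)
  have hC0 : 0 ≤ C := by
    simpa using (norm_nonneg _).trans (hline a le_rfl (ha.trans hb).le 0)
  have hR := tendsto_integral_dslope (F := F) hb.ne (integrable_vertical_div_sub hF.continuous
    (hline b (ha.trans hb).le le_rfl) hb.ne)
  have hL := tendsto_integral_dslope (F := F) ha.ne' (integrable_vertical_div_sub hF.continuous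
    (hline a le_rfl (ha.trans hb).le) ha.ne')
  have hbound : ∀ v : ℝ, v ≠ s.im → ‖∫ x in a..b, dslope F s (x + v * Complex.I)‖ ≤
      (C + ‖F s‖) / |v - s.im| * |b - a| := by
    intro v hv
    refine intervalIntegral.norm_integral_le_of_norm_le_const fun x hx => ?_
    rw [Set.uIoc_of_le (ha.trans hb).le] at hx
    have him : ((x : ℂ) + v * Complex.I - s).im = v - s.im := by simp
    have hne : (x : ℂ) + v * Complex.I ≠ s := fun h => by
      rw [h, sub_self, Complex.zero_im] at him
      exact hv (by linarith)
    have h1 : |v - s.im| ≤ ‖(x : ℂ) + v * Complex.I - s‖ := him ▸ Complex.abs_im_le_norm _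
    have h2 : ‖F (x + v * Complex.I) - F s‖ ≤ C + ‖F s‖ := by
      refine (norm_sub_le _ _).trans (add_le_add ((hline x hx.1.le hx.2 v).trans ?_) le_rfl)
      refine mul_le_of_le_one_right hC0 (inv_le_one_of_one_le₀ ?_)
      nlinarith [sq_nonneg v]
    rw [dslope_of_ne F hne, slope_def_field, norm_div]
    exact div_le_div₀ (by positivity) h2 (abs_pos.mpr (sub_ne_zero.mpr hv)) h1
  have hzero : Tendsto (fun T : ℝ => (C + ‖F s‖) / T * |b - a|) atTop (𝓝 0) := by
    simpa using (tendsto_const_nhds.div_atTop tendsto_id).mul_const |b - a|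
  have hB : Tendsto (fun T : ℝ => ∫ x in a..b, dslope F s (x + ((s.im - T : ℝ) : ℂ) * Complex.I))
      atTop (𝓝 0) := by
    refine squeeze_zero_norm' ?_ hzero
    filter_upwards [eventually_gt_atTop 0] with T hT
    have h := hbound (s.im - T) (by linarith)
    rwa [sub_sub_cancel_left, abs_neg, abs_of_pos hT] at h
  have hU : Tendsto (fun T : ℝ => ∫ x in a..b, dslope F s (x + ((s.im + T : ℝ) : ℂ) * Complex.I))
      atTop (𝓝 0) := by
    refine squeeze_zero_norm' ?_ hzero
    filter_upwards [eventually_gt_atTop 0] with T hT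
    have h := hbound (s.im + T) (by linarith)
    rwa [add_sub_cancel_left, abs_of_pos hT] at h
  have hrect : ∀ T : ℝ,
      (∫ x in a..b, dslope F s (x + ((s.im - T : ℝ) : ℂ) * Complex.I)) -
        (∫ x in a..b, dslope F s (x + ((s.im + T : ℝ) : ℂ) * Complex.I)) +
        Complex.I • (∫ y in (s.im - T)..(s.im + T), dslope F s (b + y * Complex.I)) -
        Complex.I • (∫ y in (s.im - T)..(s.im + T), dslope F s (a + y * Complex.I)) = 0 := fun T =>
    Complex.integral_boundary_rect_eq_zero_of_differentiableOn (dslope F s) ⟨a, s.im - T⟩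
      ⟨b, s.im + T⟩ (differentiable_dslope hF s).differentiableOn
  have hlim := tendsto_nhds_unique (((hB.sub hU).add (hR.const_smul Complex.I)).sub
    (hL.const_smul Complex.I)) ((tendsto_const_nhds (x := (0 : ℂ))).congr fun T => (hrect T).symm)
  rw [abs_of_pos (sub_pos.mpr hb), div_self (sub_pos.mpr hb).ne', abs_of_neg (sub_neg.mpr ha),
    neg_div, div_self (sub_neg.mpr ha).ne] at hlim
  simp only [smul_eq_mul] at hlim
  push_cast at hlim
  have hlim2 := congrArg (fun w => -Complex.I * w) hlim
  simp only [mul_zero] at hlim2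
  generalize (∫ y : ℝ, F (b + y * Complex.I) / (b + y * Complex.I - s)) = R at *
  generalize (∫ y : ℝ, F (a + y * Complex.I) / (a + y * Complex.I - s)) = L at *
  linear_combination hlim2 + (R - L - 2 * Real.pi * F s) * Complex.I_sq

/-- The case of a rapidly decaying `F`: the integral over `Re t = 1 - c` is folded back onto
`Re t = c` by `t ↦ 1 - t`. -/
theorem integral_symmetric_kernel_of_decay {F : ℂ → ℂ} (hF : Differentiable ℂ F)
    (hsymm : ∀ t, F (1 - t) = F t) {c C : ℝ}
    (hC : ∀ t : ℂ, 1 - c ≤ t.re → t.re ≤ c → ‖F t‖ ≤ C * (1 + t.im ^ 2)⁻¹) {s : ℂ}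
    (hs1 : 1 - c < s.re) (hs2 : s.re < c) :
    ∫ y : ℝ, (F (c + y * Complex.I) / (c + y * Complex.I - s) +
      F (c + y * Complex.I) / (c + y * Complex.I - (1 - s))) = 2 * Real.pi * F s := by
  have hline : ∀ y : ℝ, ‖F (c + y * Complex.I)‖ ≤ C * (1 + y ^ 2)⁻¹ := fun y => by
    simpa using hC (c + y * Complex.I) (by simp; linarith) (by simp)
  have h := integral_vertical_sub_integral_vertical hF hC hs1 hs2
  have hL : ∫ y : ℝ, F ((1 - c : ℝ) + y * Complex.I) / ((1 - c : ℝ) + y * Complex.I - s) =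
      -∫ y : ℝ, F (c + y * Complex.I) / (c + y * Complex.I - (1 - s)) := by
    rw [← MeasureTheory.integral_neg, ← MeasureTheory.integral_neg_eq_self]
    refine MeasureTheory.integral_congr_ae (Eventually.of_forall fun y => ?_)
    have e : ((1 - c : ℝ) : ℂ) + ((-y : ℝ) : ℂ) * Complex.I = 1 - (c + y * Complex.I) := by
      push_cast; ring
    simp only
    rw [e, hsymm, ← div_neg]
    congr 1
    ring
  rw [hL, sub_neg_eq_add] at h
  rw [MeasureTheory.integral_add (integrable_vertical_div_sub hF.continuous hline hs2.ne)
    (integrable_vertical_div_sub hF.continuous hline (by simp; linarith)), h]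

theorem one_add_sq_mul_exp_le {ε : ℝ} (hε : 0 < ε) (y : ℝ) :
    (1 + y ^ 2) * Real.exp (-(ε * y ^ 2)) ≤ 2 * Real.exp ε / ε ^ 2 * (1 + y ^ 2)⁻¹ := by
  have h1 : 0 < 1 + y ^ 2 := by positivity
  have h2 := Real.quadratic_le_exp_of_nonneg (x := ε * (1 + y ^ 2)) (by positivity)
  have h3 : (ε * (1 + y ^ 2)) ^ 2 / 2 ≤ Real.exp (ε * (1 + y ^ 2)) := by
    have : 0 < ε * (1 + y ^ 2) := by positivity
    linarith
  have h4 : Real.exp (ε * (1 + y ^ 2)) * Real.exp (-(ε * y ^ 2)) = Real.exp ε := by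
    rw [← Real.exp_add]; ring_nf
  rw [← div_eq_mul_inv, le_div_iff₀ h1, le_div_iff₀ (by positivity), ← h4]
  have h5 := Real.exp_pos (-(ε * y ^ 2))
  nlinarith

theorem norm_exp_mul_sq (ε : ℝ) (t : ℂ) :
    ‖Complex.exp (ε * (t - 1 / 2) ^ 2)‖ =
      Real.exp (ε * (t.re - 1 / 2) ^ 2) * Real.exp (-(ε * t.im ^ 2)) := by
  have h : ((ε : ℂ) * (t - 1 / 2) ^ 2).re = ε * (t.re - 1 / 2) ^ 2 + -(ε * t.im ^ 2) := by
    have h2 : (t - 1 / 2).re = t.re - 1 / 2 := by simp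
    have h3 : (t - 1 / 2).im = t.im := by simp
    rw [Complex.re_ofReal_mul, sq, Complex.mul_re, h2, h3]
    ring
  rw [Complex.norm_exp, h, Real.exp_add]

/-- For an entire function `F` symmetric under `t ↦ 1 - t`, of at most quadratic growth in a strip
and decaying on its edges, `F(s)` is the integral of `F(t) (1/(t-s) + 1/(t-1+s))` over one edge.
The damping factor `exp(ε(t-1/2)²)` preserves the symmetry and kills the horizontal sides of the
contour; it is removed by letting `ε → 0`. -/
theorem integral_symmetric_kernel {F : ℂ → ℂ} (hF : Differentiable ℂ F)
    (hsymm : ∀ t, F (1 - t) = F t) {c C D : ℝ}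
    (hC : ∀ t : ℂ, 1 - c ≤ t.re → t.re ≤ c → ‖F t‖ ≤ C * (1 + t.im ^ 2))
    (hD : ∀ y : ℝ, ‖F (c + y * Complex.I)‖ ≤ D * (1 + y ^ 2)⁻¹) {s : ℂ}
    (hs1 : 1 - c < s.re) (hs2 : s.re < c) :
    ∫ y : ℝ, (F (c + y * Complex.I) / (c + y * Complex.I - s) +
      F (c + y * Complex.I) / (c + y * Complex.I - (1 - s))) = 2 * Real.pi * F s := by
  set E : ℝ → ℂ → ℂ := fun ε t => Complex.exp (ε * (t - 1 / 2) ^ 2) with hE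
  have hE1 : ∀ (t : ℂ), Tendsto (fun n : ℕ => E (1 / ((n : ℝ) + 1)) t) atTop (𝓝 1) := by
    intro t
    have h0 : Tendsto (fun n : ℕ => ((1 / ((n : ℝ) + 1) : ℝ) : ℂ)) atTop (𝓝 ((0 : ℝ) : ℂ)) :=
      (Complex.continuous_ofReal.tendsto _).comp tendsto_one_div_add_atTop_nhds_zero_nat
    have h1 := Complex.continuous_exp.continuousAt.tendsto.comp (h0.mul_const ((t - 1 / 2) ^ 2))
    simpa [hE, Function.comp_def] using h1
  have hC0 : 0 ≤ C := by
    have := (norm_nonneg _).trans (hC c (by simp; linarith) (by simp))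
    simpa using this
  have hdamp : ∀ n : ℕ, ∫ y : ℝ,
      (F (c + y * Complex.I) / (c + y * Complex.I - s) +
        F (c + y * Complex.I) / (c + y * Complex.I - (1 - s))) *
        E (1 / ((n : ℝ) + 1)) (c + y * Complex.I) =
      2 * Real.pi * (F s * E (1 / ((n : ℝ) + 1)) s) := by
    intro n
    have hε : 0 < 1 / ((n : ℝ) + 1) := by positivity
    set ε := 1 / ((n : ℝ) + 1)
    have h := integral_symmetric_kernel_of_decay (F := fun t => F t * E ε t) (c := c)
      (C := C * Real.exp (ε * (c - 1 / 2) ^ 2) * (2 * Real.exp ε / ε ^ 2))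
      (hF.mul (by simp only [hE]; fun_prop))
      (fun t => by
        simp only [hE, hsymm]
        congr 3
        ring) ?_ hs1 hs2
    · rw [← h]
      refine MeasureTheory.integral_congr_ae (Eventually.of_forall fun y => ?_)
      simp only
      ring
    · intro t h1 h2
      have h3 : (t.re - 1 / 2) ^ 2 ≤ (c - 1 / 2) ^ 2 := sq_le_sq' (by linarith) (by linarith)
      have h4 := one_add_sq_mul_exp_le hε t.im
      rw [norm_mul, norm_exp_mul_sq]
      calc ‖F t‖ * (Real.exp (ε * (t.re - 1 / 2) ^ 2) * Real.exp (-(ε * t.im ^ 2)))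
          ≤ (C * (1 + t.im ^ 2)) * (Real.exp (ε * (c - 1 / 2) ^ 2) *
              Real.exp (-(ε * t.im ^ 2))) := by
            have := hC t h1 h2
            gcongr
        _ = C * Real.exp (ε * (c - 1 / 2) ^ 2) *
              ((1 + t.im ^ 2) * Real.exp (-(ε * t.im ^ 2))) := by ring
        _ ≤ C * Real.exp (ε * (c - 1 / 2) ^ 2) *
              (2 * Real.exp ε / ε ^ 2 * (1 + t.im ^ 2)⁻¹) := by gcongr
        _ = _ := by ring
  have hint : MeasureTheory.Integrable fun y : ℝ =>
      F (c + y * Complex.I) / (c + y * Complex.I - s) +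
        F (c + y * Complex.I) / (c + y * Complex.I - (1 - s)) :=
    (integrable_vertical_div_sub hF.continuous hD hs2.ne).add
      (integrable_vertical_div_sub hF.continuous hD (by simp; linarith))
  have hEc : ∀ ε : ℝ, Continuous (E ε) := fun ε => by simp only [hE]; fun_prop
  have hlhs := MeasureTheory.tendsto_integral_of_dominated_convergence
    (F := fun (n : ℕ) (y : ℝ) => (F (c + y * Complex.I) / (c + y * Complex.I - s) +
        F (c + y * Complex.I) / (c + y * Complex.I - (1 - s))) *
        E (1 / ((n : ℝ) + 1)) (c + y * Complex.I))
    (f := fun y : ℝ => F (c + y * Complex.I) / (c + y * Complex.I - s) +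
        F (c + y * Complex.I) / (c + y * Complex.I - (1 - s)))
    (fun y => ‖F (c + y * Complex.I) / (c + y * Complex.I - s) +
        F (c + y * Complex.I) / (c + y * Complex.I - (1 - s))‖ * Real.exp ((c - 1 / 2) ^ 2))
    (fun n => hint.aestronglyMeasurable.mul
      ((hEc _).comp (by fun_prop : Continuous fun y : ℝ =>
        (c : ℂ) + y * Complex.I)).aestronglyMeasurable)
    (hint.norm.mul_const _)
    (fun n => Eventually.of_forall fun y => ?_)
    (Eventually.of_forall fun y => by simpa using (hE1 (c + y * Complex.I)).const_mul _)
  · simp_rw [hdamp] at hlhs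
    have hrhs := ((hE1 s).const_mul (F s)).const_mul (2 * Real.pi : ℂ)
    rw [mul_one] at hrhs
    exact tendsto_nhds_unique hlhs hrhs
  · have hε : 0 < 1 / ((n : ℝ) + 1) := by positivity
    have hε1 : 1 / ((n : ℝ) + 1) ≤ 1 := by
      rw [div_le_one (by positivity)]
      linarith [(Nat.cast_nonneg n : (0 : ℝ) ≤ n)]
    rw [norm_mul]
    refine mul_le_mul_of_nonneg_left ?_ (norm_nonneg _)
    have hre : ((c : ℂ) + y * Complex.I).re = c := by simp
    have him : ((c : ℂ) + y * Complex.I).im = y := by simp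
    simp only [hE]
    rw [norm_exp_mul_sq, ← Real.exp_add, hre, him]
    refine Real.exp_le_exp.mpr ?_
    nlinarith [sq_nonneg (c - 1 / 2), mul_nonneg hε.le (sq_nonneg y)]

/-! ### The integral representations -/

theorem integral_riemannXi_symmetric_kernel {c : ℝ} (hc : 1 < c) {s : ℂ} (hs1 : 1 - c < s.re)
    (hs2 : s.re < c) :
    (∫ y : ℝ, riemannXi (c + y * Complex.I) / (c + y * Complex.I - s)) +
      ∫ y : ℝ, riemannXi (c + y * Complex.I) / (c + y * Complex.I - (1 - s)) =
      2 * Real.pi * riemannXi s := by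
  obtain ⟨C, hC⟩ := exists_norm_riemannXi_le (1 - c) c
  obtain ⟨D, hD⟩ := exists_norm_riemannXi_vertical_le hc
  rw [← integral_symmetric_kernel differentiable_riemannXi riemannXi_one_sub hC hD hs1 hs2,
    MeasureTheory.integral_add (integrable_riemannXi_div_sub hc hs2.ne)
      (integrable_riemannXi_div_sub hc (by simp; linarith))]

/-- The symmetric kernel at `s = 0` gives the sum of the integrals of `ξ(t)/t` and `ξ(t)/(t-1)`,
and the vertical integral of the completed zeta function gives their difference. -/
theorem integral_riemannXi_div {c : ℝ} (hc : 1 < c) :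
    2 * ∫ y : ℝ, riemannXi (c + y * Complex.I) / (c + y * Complex.I - 0) =
      2 * Real.pi * (1 - thetaThree 1 / 2) := by
  have h1 := integral_riemannXi_symmetric_kernel (s := 0) hc (by simp; linarith)
    (by simp; linarith)
  have h2 := integral_completedRiemannZeta_vertical hc
  simp_rw [completedRiemannZeta_vertical hc] at h2
  rw [MeasureTheory.integral_const_mul, MeasureTheory.integral_sub
    (integrable_riemannXi_div_sub hc (by simp; linarith))
    (integrable_riemannXi_div_sub hc (by simp; linarith))] at h2
  rw [riemannXi_zero, sub_zero 1] at h1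
  linear_combination h1 - h2 / 2

theorem theorem1 (s : ℂ) (hs0 : 0 < s.re) (hs1 : s.re < 1) (c : ℝ) (hc1 : 1 < c) (hc2 : c < 2) :
    (Complex.VerticalIntegrable (fun t =>
        xi t / t * ((2 * s * (1 - s) - t) / (s * (1 - s) - t * (1 - t)))) c ∧
      xi s = ((1 - Real.pi ^ (1 / 4 : ℝ) / (2 * Real.Gamma (3 / 4)) : ℝ) : ℂ)
        - 1 / (2 * (Real.pi : ℂ) * Complex.I) * verticalLineIntegral c (fun t =>
          xi t / t * ((2 * s * (1 - s) - t) / (s * (1 - s) - t * (1 - t))))) ∧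
    (Complex.VerticalIntegrable (fun t =>
        xi t / t * (1 / (1 - t) - (2 * s * (1 - s) - t) / (s * (1 - s) - t * (1 - t)))) c ∧
      xi s = 1 / 2 + 1 / (2 * (Real.pi : ℂ) * Complex.I) * verticalLineIntegral c (fun t =>
        xi t / t * (1 / (1 - t) - (2 * s * (1 - s) - t) / (s * (1 - s) - t * (1 - t))))) := by
  -- The four building blocks `ξ(t) / (t - p)`, with `p` one of `0`, `1`, `s`, `1 - s`.
  have hp0 : (0 : ℂ).re ≠ c := by rw [Complex.zero_re]; linarith
  have hp1 : (1 : ℂ).re ≠ c := by rw [Complex.one_re]; linarith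
  have hps : s.re ≠ c := by linarith
  have hpr : (1 - s).re ≠ c := by rw [Complex.sub_re, Complex.one_re]; linarith
  have i0 := integrable_riemannXi_div_sub hc1 hp0
  have i1 := integrable_riemannXi_div_sub hc1 hp1
  have is := integrable_riemannXi_div_sub hc1 hps
  have ir := integrable_riemannXi_div_sub hc1 hpr
  have hxi : ∀ y : ℝ, xi (c + y * Complex.I) = riemannXi (c + y * Complex.I) := fun y =>
    xi_eq_riemannXi (by simp; linarith) (sub_ne_zero.mp (add_mul_I_sub_ne_zero hp1 y))
  -- Partial fractions of the two kernels.
  have hk1 : ∀ y : ℝ, xi (c + y * Complex.I) / (c + y * Complex.I) *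
      ((2 * s * (1 - s) - (c + y * Complex.I)) /
        (s * (1 - s) - (c + y * Complex.I) * (1 - (c + y * Complex.I)))) =
      2 * (riemannXi (c + y * Complex.I) / (c + y * Complex.I - 0)) -
        (riemannXi (c + y * Complex.I) / (c + y * Complex.I - s) +
          riemannXi (c + y * Complex.I) / (c + y * Complex.I - (1 - s))) := by
    intro y
    have h0 := add_mul_I_sub_ne_zero hp0 y
    have hs := add_mul_I_sub_ne_zero hps y
    have hr := add_mul_I_sub_ne_zero hpr y
    rw [hxi]
    generalize (c : ℂ) + y * Complex.I = t at *
    rw [sub_zero] at h0 ⊢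
    have e : s * (1 - s) - t * (1 - t) = (t - s) * (t - (1 - s)) := by ring
    rw [e]
    field_simp
    ring
  have hk2 : ∀ y : ℝ, xi (c + y * Complex.I) / (c + y * Complex.I) *
      (1 / (1 - (c + y * Complex.I)) - (2 * s * (1 - s) - (c + y * Complex.I)) /
        (s * (1 - s) - (c + y * Complex.I) * (1 - (c + y * Complex.I)))) =
      (riemannXi (c + y * Complex.I) / (c + y * Complex.I - s) +
          riemannXi (c + y * Complex.I) / (c + y * Complex.I - (1 - s))) -
        (riemannXi (c + y * Complex.I) / (c + y * Complex.I - 0) +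
          riemannXi (c + y * Complex.I) / (c + y * Complex.I - 1)) := by
    intro y
    have h0 := add_mul_I_sub_ne_zero hp0 y
    have h1 := add_mul_I_sub_ne_zero hp1 y
    rw [mul_sub, hk1 y, hxi]
    generalize (c : ℂ) + y * Complex.I = t at *
    have h1' : 1 - t ≠ 0 := by rw [← neg_sub]; exact neg_ne_zero.mpr h1
    rw [sub_zero] at h0 ⊢
    have e : riemannXi t / t * (1 / (1 - t)) = riemannXi t / t - riemannXi t / (t - 1) := by
      field_simp
      ring
    rw [e]
    ring
  have hcauchy := integral_riemannXi_symmetric_kernel (s := s) hc1 (by linarith) (by linarith)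
  have hcauchy0 := integral_riemannXi_symmetric_kernel (s := 0) hc1 (by simp; linarith)
    (by simp; linarith)
  have hzero := integral_riemannXi_div hc1
  rw [riemannXi_zero, sub_zero 1] at hcauchy0
  have hxis : xi s = riemannXi s := xi_eq_riemannXi hs0 fun h => by
    rw [h, Complex.one_re] at hs1; linarith
  have hpi : (Real.pi : ℂ) ≠ 0 := Complex.ofReal_ne_zero.mpr Real.pi_ne_zero
  have hconst : (1 - Real.pi ^ (1 / 4 : ℝ) / (2 * Real.Gamma (3 / 4)) : ℝ) =
      1 - thetaThree 1 / 2 := by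
    rw [thetaThree_one, div_div, mul_comm 2]
  refine ⟨⟨?_, ?_⟩, ?_, ?_⟩
  · rw [Complex.VerticalIntegrable]
    simp_rw [hk1]
    exact (i0.const_mul 2).sub (is.fun_add ir)
  · simp only [verticalLineIntegral, hk1]
    rw [MeasureTheory.integral_mul_const, MeasureTheory.integral_sub (i0.const_mul 2) (is.fun_add ir),
      MeasureTheory.integral_const_mul, hzero, MeasureTheory.integral_add is ir, hcauchy, hxis,
      hconst]
    push_cast
    field_simp
    ring
  · rw [Complex.VerticalIntegrable]
    simp_rw [hk2]
    exact (is.fun_add ir).sub (i0.fun_add i1)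
  · simp only [verticalLineIntegral, hk2]
    rw [MeasureTheory.integral_mul_const, MeasureTheory.integral_sub (is.fun_add ir) (i0.fun_add i1),
      MeasureTheory.integral_add is ir, MeasureTheory.integral_add i0 i1, hcauchy, hcauchy0, hxis]
    field_simp
    ring
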